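/- Let $\mathfrak H$ be a complex Hilbert space, let $(\sigma,\tau)\subseteq\mathbb R$ be an open interval (with possibly infinite end points), and let $F(\lambda)$, $\lambda\in(\sigma,\tau)$, be an operator function such that: 1. for every $\lambda\in(\sigma,\tau)$ the operator $F(\lambda)$ is a self-adjoint operator in $\mathfrak H$ with compact resolvent; 2. for every $\lambda_0\in(\sigma,\tau)$ there are a real number $\mu$ and a neighbourhood $U\Subset(\sigma,\tau)$ of $\lambda_0$ such that $F(\lambda)-\mu\ge 0$ for all $\lambda\in U$; 3. the function $\lambda\mapsto(F(\lambda)-i)^{-1}$ is continuous on $(\sigma,\tau)$ in the operator norm. A number $\lambda_0\in(\sigma,\tau)$ is called an eigenvalue of multiplicity $m$ of the operator function $F$ if $0$ is an eigenvalue of multiplicity $m$ of the operator $F(\lambda_0)$. For $[\xi_1,\xi_2)\Subset(\sigma,\tau)$ let $\mathcal N_F(\xi_1,\xi_2)$ be the number of eigenvalues of $F$ in $[\xi_1,\xi_2)$, and for $\lambda\in(\sigma,\tau)$ let $\nu_F(\lambda)$ be the number of negative eigenvalues of the operator $F(\lambda)$, in both cases counted with multiplicity. For $\lambda\in(\sigma,\tau)$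 let $\mathfrak f(\lambda)$ be the closure of the quadratic form $\langle F(\lambda)y,y\rangle$ defined on the domain of $F(\lambda)$. Assume that the domain of $\mathfrak f(\lambda)$ is one and the same subspace $\mathfrak D(\mathfrak f)\subseteq\mathfrak H$ for all $\lambda\in(\sigma,\tau)$, and that for all $\lambda_1<\lambda_2$ in $(\sigma,\tau)$ $$\mathfrak f(\lambda_1)[y]-\mathfrak f(\lambda_2)[y]>0\qquad\text{for all } y\in\mathfrak D(\mathfrak f),\ y\ne 0.$$ Then for every half-open interval $[\xi_1,\xi_2)\Subset(\sigma,\tau)$ (that is, $\sigma<\xi_1<\xi_2<\tau$) the numbers $\mathcal N_F(\xi_1,\xi_2)$, $\nu_F(\xi_1)$, $\nu_F(\xi_2)$ are finite and $$\mathcal N_F(\xi_1,\xi_2)=\nu_F(\xi_2)-\nu_F(\xi_1).$$ -/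

import Mathlib

open Filter Topology

namespace SpectralCount

variable {H : Type*} [NormedAddCommGroup H] [InnerProductSpace ℂ H]

/-! ### Unbounded operators: resolvents, eigenspaces -/

/-- The bounded operator `R` is the resolvent `(A - z)⁻¹` of the partially defined operator `A`:
it maps `H` into the domain of `A` and is a two-sided inverse of `A - z : dom A → H`. -/
def IsResolventAt (A : H →ₗ.[ℂ] H) (z : ℂ) (R : H →L[ℂ] H) : Prop :=
  (∀ x : H, ∃ y : A.domain, (y : H) = R x ∧ A y - z • (y : H) = x) ∧
    ∀ y : A.domain, R (A y - z • (y : H)) = y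

/-- `A` has compact resolvent: `(A - z)⁻¹` exists and is a compact operator for some `z`. -/
def HasCompactResolvent (A : H →ₗ.[ℂ] H) : Prop :=
  ∃ (z : ℂ) (R : H →L[ℂ] H), IsResolventAt A z R ∧ IsCompactOperator R

/-- The operator `A - μ` is nonnegative. -/
def IsBoundedBelowBy (A : H →ₗ.[ℂ] H) (μ : ℝ) : Prop :=
  ∀ y : A.domain, μ * ‖(y : H)‖ ^ 2 ≤ (inner ℂ (A y) (y : H)).re

/-- The space of all `y ∈ dom A` with `A y = z y`. -/
def eigenspace (A : H →ₗ.[ℂ] H) (z : ℂ) : Submodule ℂ H :=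
  (LinearMap.ker (A.toFun - z • A.domain.subtype)).map A.domain.subtype

/-- The multiplicity of `z` as an eigenvalue of `A` (zero if `z` is not an eigenvalue). -/
noncomputable def multiplicity (A : H →ₗ.[ℂ] H) (z : ℂ) : ℕ∞ :=
  Cardinal.toENat (Module.rank ℂ (eigenspace A z))

/-! ### Counting functions -/

/-- The sum of the `ℕ∞`-valued function `m` over the (possibly infinite) set `S` of reals. -/
noncomputable def countOn (S : Set ℝ) (m : ℝ → ℕ∞) : ℕ∞ :=
  ⨆ (s : Finset ℝ) (_ : (s : Set ℝ) ⊆ S), ∑ t ∈ s, m t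

/-- The number of negative eigenvalues of `A`, counted with multiplicity. -/
noncomputable def numNegEigenvalues (A : H →ₗ.[ℂ] H) : ℕ∞ :=
  countOn (Set.Iio 0) fun t => multiplicity A (t : ℂ)

/-- The number of eigenvalues of the operator function `F` in `[ξ₁, ξ₂)`, counted with
multiplicity; `t` is an eigenvalue of `F` of multiplicity `m` if `0` is an eigenvalue of `F t` of
multiplicity `m`. -/
noncomputable def numEigenvaluesIco (F : ℝ → H →ₗ.[ℂ] H) (ξ₁ ξ₂ : ℝ) : ℕ∞ :=
  countOn (Set.Ico ξ₁ ξ₂) fun t => multiplicity (F t) 0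

/-! ### The class of operator functions -/

/-- The open interval `(σ, τ)` of the real line, with possibly infinite end points. -/
def openInterval (σ τ : EReal) : Set ℝ := {t : ℝ | σ < (t : EReal) ∧ (t : EReal) < τ}

/-- The operator functions on `(σ, τ)` under consideration (values outside `(σ, τ)` play no role):
the values are self-adjoint with compact resolvent, locally uniformly bounded below, and the
resolvent `(F(λ) - i)⁻¹` depends continuously on `λ` in the operator norm. -/
structure IsAdmissible [CompleteSpace H] (σ τ : EReal) (F : ℝ → H →ₗ.[ℂ] H) : Prop where
  selfAdjoint : ∀ t ∈ openInterval σ τ, IsSelfAdjoint (F t)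
  compactResolvent : ∀ t ∈ openInterval σ τ, HasCompactResolvent (F t)
  locallyBoundedBelow : ∀ t ∈ openInterval σ τ, ∃ μ : ℝ, ∀ᶠ s in 𝓝 t, IsBoundedBelowBy (F s) μ
  continuousResolvent : ∃ R : ℝ → H →L[ℂ] H,
    (∀ t ∈ openInterval σ τ, IsResolventAt (F t) Complex.I (R t)) ∧
      ContinuousOn R (openInterval σ τ)

/-! ### Quadratic forms with a domain, and their closures -/

variable (H) in
/-- A sesquilinear form (conjugate linear in the first argument) defined on a linear subspace
of `H`. -/
structure PartialForm where
  /-- the domain of the form -/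
  domain : Submodule ℂ H
  /-- the form itself -/
  form : domain →ₗ⋆[ℂ] domain →ₗ[ℂ] ℂ

/-- The value `𝔱[y]` of the associated quadratic form. -/
def PartialForm.quad (𝔱 : PartialForm H) (y : 𝔱.domain) : ℂ := 𝔱.form y y

/-- The form of an operator `A`: its domain is `dom A`, its quadratic form is `⟨A y, y⟩`. -/
noncomputable def operatorForm (A : H →ₗ.[ℂ] H) : PartialForm H where
  domain := A.domain
  form := ((innerₛₗ ℂ : H →ₗ⋆[ℂ] H →ₗ[ℂ] ℂ).comp A.toFun).compl₂ A.domain.subtype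

/-- The sequence `x` in the domain of `𝔱` is `𝔱`-convergent to `u`: `xₙ → u` in `H` and
`𝔱[xₙ - xₘ] → 0` as `n, m → ∞`. -/
def PartialForm.Converges (𝔱 : PartialForm H) (x : ℕ → 𝔱.domain) (u : H) : Prop :=
  Tendsto (fun n => (x n : H)) atTop (𝓝 u) ∧
    Tendsto (fun p : ℕ × ℕ => 𝔱.quad (x p.1 - x p.2)) atTop (𝓝 0)

/-- `𝔠` is the closure of the (semibounded) form `𝔱`: its domain consists of the limits of all
`𝔱`-convergent sequences, and `𝔠[u] = lim 𝔱[xₙ]` for every sequence `𝔱`-convergent to `u`. -/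
structure PartialForm.IsClosureOf (𝔠 𝔱 : PartialForm H) : Prop where
  mem_domain_iff : ∀ u : H, u ∈ 𝔠.domain ↔ ∃ x : ℕ → 𝔱.domain, 𝔱.Converges x u
  tendsto_quad : ∀ (u : 𝔠.domain) (x : ℕ → 𝔱.domain), 𝔱.Converges x u →
    Tendsto (fun n => 𝔱.quad (x n)) atTop (𝓝 (𝔠.quad u))

end SpectralCount

/-!
For `A = F t` let `negSpan A` and `nonposSpan A` be the spans of the eigenspaces for negative and
for nonpositive eigenvalues. Both are finite-dimensional; write `n t` for the dimension of the
former, so that the dimension of the latter is `n t + m t`, where `m t` is the multiplicity of `t`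
as an eigenvalue of `F`. Two facts determine how `n` changes with `t`.

* Monotonicity: `n s + m s ≤ n t` for `s < t` (`finrank_nonposSpan_le_finrank_negSpan`). The form
  of `F s` is nonpositive on `nonposSpan (F s)`, so the form of `F t` is negative on its nonzero
  vectors; the latter form is nonnegative on the orthogonal complement of `negSpan (F t)`, so
  `nonposSpan (F s)` meets this complement trivially and is mapped injectively into
  `negSpan (F t)` by the orthogonal projection.
* Semicontinuity: near `t` one has `n t ≤ n s` and `n s + m s ≤ n t + m t`
  (`IsAdmissible.eventually_finrank_le`), because the resolvents depend continuously on the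
  parameter.

Together they say that near `t` there are no other eigenvalues of `F`, that `n s = n t` on the left
of `t`, and that `n s = n t + m t` on the right of `t`. Summing the jumps over `[ξ₁, ξ₂)` gives the
formula (`exists_finset_sum_jumps`).

The spectral theory is carried out for the bounded operator `S = (A - c)⁻¹` at a real point `c < 0`
below the spectrum of `A`, which exists by the Fredholm alternative applied to `(A - i)⁻¹`. It is
compact, symmetric and positive, and an eigenvalue `t` of `A` corresponds to the eigenvalue
`(t - c)⁻¹` of `S`; the condition `t < 0` becomes `(t - c)⁻¹ > (-c)⁻¹`. The form of `A` at `S x` is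
the form of `S + c S²` at `x`, whose sign on a span of eigenspaces of `S` and on its orthogonal
complement is read off from the eigenvalues.
-/

namespace SpectralCount

/-! ### Dimension and orthogonality -/

section Dimension

variable {H : Type*} [NormedAddCommGroup H] [InnerProductSpace ℂ H]

/-- The orthogonal projection onto `N` is injective on a subspace that meets `Nᗮ` trivially. -/
theorem finrank_le_of_disjoint_orthogonal (V N : Submodule ℂ H) [FiniteDimensional ℂ N]
    (h : ∀ x ∈ V, x ∈ Nᗮ → x = 0) : Module.finrank ℂ V ≤ Module.finrank ℂ N := by
  refine LinearMap.finrank_le_finrank_of_injective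
    (f := (N.orthogonalProjectionOnto : H →ₗ[ℂ] N).comp V.subtype) ?_
  rw [← LinearMap.ker_eq_bot, LinearMap.ker_eq_bot']
  intro x hx
  have hx' : N.orthogonalProjectionOnto (x : H) = 0 := hx
  rw [Submodule.orthogonalProjectionOnto_eq_zero_iff] at hx'
  exact Subtype.ext (h x x.2 hx')

theorem finrank_biSup_finset {ι : Type*} [DecidableEq ι] {V : ι → Submodule ℂ H}
    (hV : iSupIndep V) (s : Finset ι) (hfin : ∀ i ∈ s, FiniteDimensional ℂ (V i)) :
    Module.finrank ℂ (⨆ i ∈ s, V i : Submodule ℂ H) = ∑ i ∈ s, Module.finrank ℂ (V i) := by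
  induction s using Finset.induction_on with
  | empty => rw [show (⨆ i ∈ (∅ : Finset ι), V i) = ⊥ by simp]; simp
  | insert a s ha ih =>
    have h1 : FiniteDimensional ℂ (V a) := hfin a (by simp)
    have h2 : ∀ i ∈ s, FiniteDimensional ℂ (V i) := fun i hi => hfin i (by simp [hi])
    have h3 : FiniteDimensional ℂ (⨆ i ∈ s, V i : Submodule ℂ H) := by
      rw [← Finset.sup_eq_iSup]
      exact (Submodule.fg_iff_finiteDimensional _).1
        (Submodule.fg_finset_sup s V fun i hi => (Submodule.fg_iff_finiteDimensional _).2 (h2 i hi))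
    rw [Finset.iSup_insert, Finset.sum_insert ha, ← ih h2]
    have hd : Disjoint (V a) (⨆ i ∈ s, V i) := hV.disjoint_biSup (y := (s : Set ι)) ha
    have := Submodule.finrank_sup_add_finrank_inf_eq (V a) (⨆ i ∈ s, V i)
    rw [hd.eq_bot, finrank_bot] at this
    omega

end Dimension

/-! ### Counting with multiplicity -/

section Counting

theorem countOn_eq_sum {S : Set ℝ} {m : ℝ → ℕ∞} (s : Finset ℝ) (hs : (s : Set ℝ) ⊆ S)
    (h : ∀ t ∈ S, t ∉ s → m t = 0) : countOn S m = ∑ t ∈ s, m t := by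
  refine le_antisymm (iSup₂_le fun r hr => ?_) (le_iSup₂_of_le s hs le_rfl)
  refine Finset.sum_le_sum_of_ne_zero fun t ht hne => ?_
  by_contra hts
  exact hne (h t (hr ht) hts)

variable {H : Type*} [NormedAddCommGroup H] [InnerProductSpace ℂ H]

theorem toENat_rank_eq_finrank (V : Submodule ℂ H) [FiniteDimensional ℂ V] :
    Cardinal.toENat (Module.rank ℂ V) = (Module.finrank ℂ V : ℕ∞) := by
  rw [← Module.finrank_eq_rank]; simp

theorem finite_setOf_ne_bot {V : ℝ → Submodule ℂ H} (hV : iSupIndep V) (B : Set ℝ)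
    [FiniteDimensional ℂ (⨆ t ∈ B, V t : Submodule ℂ H)] :
    {t | t ∈ B ∧ V t ≠ ⊥}.Finite := by
  by_contra hinf
  obtain ⟨s, hs, hcard⟩ := Set.Infinite.exists_subset_card_eq hinf
    (Module.finrank ℂ (⨆ t ∈ B, V t : Submodule ℂ H) + 1)
  have hle : ∀ t ∈ B, V t ≤ ⨆ t ∈ B, V t := fun t ht => le_iSup₂_of_le t ht le_rfl
  have hfin : ∀ t ∈ s, FiniteDimensional ℂ (V t) := fun t ht =>
    Submodule.finiteDimensional_of_le (hle t (hs ht).1)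
  have h1 := finrank_biSup_finset hV s hfin
  have h2 : Module.finrank ℂ (⨆ t ∈ s, V t : Submodule ℂ H) ≤
      Module.finrank ℂ (⨆ t ∈ B, V t : Submodule ℂ H) :=
    Submodule.finrank_mono (iSup₂_le fun t ht => hle t (hs ht).1)
  have h3 : s.card ≤ ∑ t ∈ s, Module.finrank ℂ (V t) := by
    rw [Finset.card_eq_sum_ones]
    refine Finset.sum_le_sum fun t ht => ?_
    have := hfin t ht
    exact Submodule.one_le_finrank_iff.mpr (hs ht).2
  omega

theorem countOn_rank {V : ℝ → Submodule ℂ H} (hV : iSupIndep V) (B : Set ℝ)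
    [FiniteDimensional ℂ (⨆ t ∈ B, V t : Submodule ℂ H)] :
    countOn B (fun t => Cardinal.toENat (Module.rank ℂ (V t))) =
      (Module.finrank ℂ (⨆ t ∈ B, V t : Submodule ℂ H) : ℕ∞) := by
  have hle : ∀ t ∈ B, V t ≤ ⨆ t ∈ B, V t := fun t ht => le_iSup₂_of_le t ht le_rfl
  have hfin : ∀ t ∈ B, FiniteDimensional ℂ (V t) := fun t ht =>
    Submodule.finiteDimensional_of_le (hle t ht)
  have hs := finite_setOf_ne_bot hV B
  have hsB : ∀ t ∈ hs.toFinset, t ∈ B := fun t ht => ((hs.mem_toFinset).1 ht).1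
  have hbot : ∀ t ∈ B, t ∉ hs.toFinset → V t = ⊥ := fun t ht hts => by
    by_contra hne
    exact hts ((hs.mem_toFinset).2 ⟨ht, hne⟩)
  rw [countOn_eq_sum hs.toFinset hsB fun t ht hts => by simp [hbot t ht hts]]
  have heq : (⨆ t ∈ B, V t) = ⨆ t ∈ hs.toFinset, V t := by
    refine le_antisymm (iSup₂_le fun t ht => ?_) (iSup₂_le fun t ht => hle t (hsB t ht))
    by_cases hts : t ∈ hs.toFinset
    · exact le_iSup₂_of_le t hts le_rfl
    · rw [hbot t ht hts]; exact bot_le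
  rw [heq, finrank_biSup_finset hV _ fun t ht => hfin t (hsB t ht)]
  push_cast
  refine Finset.sum_congr rfl fun t ht => ?_
  have := hfin t (hsB t ht)
  exact toENat_rank_eq_finrank _

/-- A function `n` that is locally constant except for jumps of size `m t` immediately to the
right of isolated points `t` increases over `[a, b]` by the sum of the jumps in `[a, b)`. -/
theorem exists_finset_sum_jumps {n m : ℝ → ℕ} {a b : ℝ} (hab : a ≤ b)
    (hleft : ∀ t ∈ Set.Icc a b, ∀ᶠ s in 𝓝 t, s < t → m s = 0 ∧ n s = n t)
    (hright : ∀ t ∈ Set.Icc a b, ∀ᶠ s in 𝓝 t, t < s → m s = 0 ∧ n s = n t + m t) :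
    ∃ s : Finset ℝ, (s : Set ℝ) ⊆ Set.Ico a b ∧ (∀ t ∈ Set.Ico a b, t ∉ s → m t = 0) ∧
      n b = n a + ∑ t ∈ s, m t := by
  classical
  let P : ℝ → Prop := fun x => ∃ s : Finset ℝ, (s : Set ℝ) ⊆ Set.Ico a x ∧
    (∀ t ∈ Set.Ico a x, t ∉ s → m t = 0) ∧ n x = n a + ∑ t ∈ s, m t
  suffices h : Set.Icc a b ⊆ {x | ∀ y ∈ Set.Icc a x, P y} from
    h ⟨hab, le_rfl⟩ b ⟨hab, le_rfl⟩
  -- a jump-free step and a step across one jump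
  have hstepL : ∀ x t, a ≤ x → x < t → P x → (∀ u ∈ Set.Ico x t, m u = 0 ∧ n u = n t) → P t := by
    rintro x t hax hxt ⟨s, hs, hm, hn⟩ hu
    refine ⟨s, fun u huS => ⟨(hs huS).1, (hs huS).2.trans hxt⟩, fun u hu1 hus => ?_, ?_⟩
    · rcases lt_or_ge u x with h | h
      · exact hm u ⟨hu1.1, h⟩ hus
      · exact (hu u ⟨h, hu1.2⟩).1
    · rw [← hn, (hu x ⟨le_rfl, hxt⟩).2]
  have hstepR : ∀ t y, a ≤ t → t < y → P t → (∀ u ∈ Set.Ioc t y, m u = 0 ∧ n u = n t + m t) →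
      P y := by
    rintro t y hat hty ⟨s, hs, hm, hn⟩ hu
    have hts : t ∉ s := fun h => lt_irrefl t (hs h).2
    refine ⟨insert t s, ?_, fun u hu1 hus => ?_, ?_⟩
    · rw [Finset.coe_insert, Set.insert_subset_iff]
      exact ⟨⟨hat, hty⟩, fun u huS => ⟨(hs huS).1, (hs huS).2.trans hty⟩⟩
    · rw [Finset.mem_insert, not_or] at hus
      rcases lt_or_ge t u with h | h
      · exact (hu u ⟨h, hu1.2.le⟩).1
      · exact hm u ⟨hu1.1, lt_of_le_of_ne h hus.1⟩ hus.2
    · rw [Finset.sum_insert hts, (hu y ⟨hty, le_rfl⟩).2, hn]; ring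
  refine IsClosed.Icc_subset_of_forall_mem_nhdsWithin ?_ ?_ ?_
  · rw [← isSeqClosed_iff_isClosed]
    intro x t hx hxt
    have htI : t ∈ Set.Icc a b := isClosed_Icc.mem_of_tendsto hxt (Eventually.of_forall
      fun k => (hx k).2)
    refine ⟨fun y hy => ?_, htI⟩
    rcases hy.2.lt_or_eq with hlt | rfl
    · obtain ⟨k, hk⟩ := (hxt.eventually (lt_mem_nhds hlt)).exists
      exact (hx k).1 y ⟨hy.1, hk.le⟩
    · obtain ⟨l, hl, hball⟩ := exists_Ioc_subset_of_mem_nhds (hleft y htI) (exists_lt y)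
      obtain ⟨k, hk⟩ := (hxt.eventually (lt_mem_nhds hl)).exists
      rcases lt_or_ge (x k) y with h | h
      · exact hstepL (x k) y (hx k).2.1 h ((hx k).1 _ ⟨(hx k).2.1, le_rfl⟩)
          fun u hu => hball ⟨hk.trans_le hu.1, hu.2.le⟩ hu.2
      · exact (hx k).1 y ⟨hy.1, h⟩
  · intro y hy
    obtain rfl : y = a := le_antisymm hy.2 hy.1
    exact ⟨∅, by simp, fun t ht => absurd (ht.1.trans_lt ht.2) (lt_irrefl _), by simp⟩
  · rintro t ⟨htP, ht⟩
    obtain ⟨r, hr, hball⟩ := exists_Ico_subset_of_mem_nhds (hright t ⟨ht.1, ht.2.le⟩) (exists_gt t)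
    filter_upwards [Ioo_mem_nhdsGT hr] with y hy z hz
    rcases le_or_gt z t with h | h
    · exact htP z ⟨hz.1, h⟩
    · exact hstepR t z ht.1 h (htP t ⟨ht.1, le_rfl⟩)
        fun u hu => hball ⟨hu.1.le, (hu.2.trans hz.2).trans_lt hy.2⟩ hu.1

end Counting

/-! ### Compact self-adjoint operators -/

section Compact

open Module.End

variable {H : Type*} [NormedAddCommGroup H] [InnerProductSpace ℂ H]

/-- The algebraic span of the eigenspaces of `S` for the real eigenvalues in `B`. -/
noncomputable def eigSpan (S : H →L[ℂ] H) (B : Set ℝ) : Submodule ℂ H :=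
  ⨆ μ : B, Module.End.eigenspace (S : H →ₗ[ℂ] H) ((μ : ℝ) : ℂ)

theorem eigenspace_le_eigSpan (S : H →L[ℂ] H) {B : Set ℝ} {μ : ℝ} (hμ : μ ∈ B) :
    Module.End.eigenspace (S : H →ₗ[ℂ] H) (μ : ℂ) ≤ eigSpan S B :=
  le_iSup (fun μ : B => Module.End.eigenspace (S : H →ₗ[ℂ] H) ((μ : ℝ) : ℂ)) ⟨μ, hμ⟩

theorem eigSpan_le {S : H →L[ℂ] H} {B : Set ℝ} {V : Submodule ℂ H}
    (h : ∀ μ ∈ B, Module.End.eigenspace (S : H →ₗ[ℂ] H) (μ : ℂ) ≤ V) : eigSpan S B ≤ V :=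
  iSup_le fun μ => h μ μ.2

theorem eigSpan_mono_of_ne_bot {S : H →L[ℂ] H} {B B' : Set ℝ}
    (h : ∀ μ ∈ B, Module.End.eigenspace (S : H →ₗ[ℂ] H) (μ : ℂ) ≠ ⊥ → μ ∈ B') :
    eigSpan S B ≤ eigSpan S B' := by
  refine eigSpan_le fun μ hμ => ?_
  by_cases hb : Module.End.eigenspace (S : H →ₗ[ℂ] H) (μ : ℂ) = ⊥
  · rw [hb]; exact bot_le
  · exact eigenspace_le_eigSpan S (h μ hμ hb)

theorem mem_eigenspace_clm {S : H →L[ℂ] H} {z : ℂ} {x : H} :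
    x ∈ Module.End.eigenspace (S : H →ₗ[ℂ] H) z ↔ S x = z • x :=
  Module.End.mem_eigenspace_iff

theorem map_mem_eigSpan {S : H →L[ℂ] H} {B : Set ℝ} {x : H} (hx : x ∈ eigSpan S B) :
    S x ∈ eigSpan S B := by
  have : eigSpan S B ≤ (eigSpan S B).comap (S : H →ₗ[ℂ] H) := eigSpan_le fun μ hμ y hy => by
    have hy' := mem_eigenspace_clm.1 hy
    rw [Submodule.mem_comap]
    change S y ∈ _
    rw [hy']
    exact Submodule.smul_mem _ _ (eigenspace_le_eigSpan S hμ hy)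
  exact this hx

theorem exists_preimage_mem_eigSpan {S : H →L[ℂ] H} {B : Set ℝ} (hB : (0 : ℝ) ∉ B) {x : H}
    (hx : x ∈ eigSpan S B) : ∃ y ∈ eigSpan S B, S y = x := by
  have : eigSpan S B ≤ (eigSpan S B).map (S : H →ₗ[ℂ] H) := eigSpan_le fun μ hμ y hy => by
    have hy' := mem_eigenspace_clm.1 hy
    have hμ0 : (μ : ℂ) ≠ 0 := by
      rw [Complex.ofReal_ne_zero]; rintro rfl; exact hB hμ
    refine ⟨(μ : ℂ)⁻¹ • y, Submodule.smul_mem _ _ (eigenspace_le_eigSpan S hμ hy), ?_⟩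
    change S ((μ : ℂ)⁻¹ • y) = y
    rw [map_smul, hy', smul_smul, inv_mul_cancel₀ hμ0, one_smul]
  exact this hx

/-- If `Q` acts on the eigenspaces of `S` as multiplication by a function `q` of the eigenvalue
that is nonnegative on the eigenvalues in `B`, then the form of `Q` is nonnegative on
`eigSpan S B`, because eigenspaces are mutually orthogonal. -/
theorem re_inner_nonneg_of_mem_eigSpan {S Q : H →L[ℂ] H} (hS : (S : H →ₗ[ℂ] H).IsSymmetric)
    {q : ℝ → ℝ} (hQ : ∀ (μ : ℝ) (x : H), S x = (μ : ℂ) • x → Q x = (q μ : ℂ) • x) {B : Set ℝ}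
    (hq : ∀ μ ∈ B, Module.End.eigenspace (S : H →ₗ[ℂ] H) (μ : ℂ) ≠ ⊥ → 0 ≤ q μ) {x : H}
    (hx : x ∈ eigSpan S B) : 0 ≤ (inner ℂ (Q x) x).re := by
  obtain ⟨g, hg, rfl⟩ := (Submodule.mem_iSup_iff_exists_finsupp _ _).1 hx
  have horth := hS.orthogonalFamily_eigenspaces.comp (γ := B) (f := fun μ : B => ((μ : ℝ) : ℂ))
    (Complex.ofReal_injective.comp Subtype.val_injective)
  have hgQ : ∀ μ : B, Q (g μ) = (q μ : ℂ) • g μ := fun μ =>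
    hQ μ _ (mem_eigenspace_clm.1 (hg μ))
  have key := horth.inner_sum (fun μ => (q μ : ℂ) • ⟨g μ, hg μ⟩) (fun μ => ⟨g μ, hg μ⟩) g.support
  have e1 : Q (g.sum fun _ y => y) = ∑ μ ∈ g.support, (q μ : ℂ) • g μ := by
    rw [Finsupp.sum, map_sum]
    exact Finset.sum_congr rfl fun μ _ => hgQ μ
  have e2 : inner ℂ (∑ μ ∈ g.support, (q μ : ℂ) • g μ) (g.sum fun _ y => y) =
      ∑ μ ∈ g.support, inner ℂ ((q μ : ℂ) • g μ) (g μ) := key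
  rw [e1, e2, Complex.re_sum]
  refine Finset.sum_nonneg fun μ _ => ?_
  rw [inner_smul_left, Complex.conj_ofReal, Complex.re_ofReal_mul]
  by_cases hb : g μ = 0
  · simp [hb]
  · exact mul_nonneg (hq μ μ.2 fun h => hb ((Submodule.eq_bot_iff _).1 h _ (hg μ)))
      (inner_self_nonneg (𝕜 := ℂ))

theorem isClosed_setOf_re_inner_nonneg (Q : H →L[ℂ] H) :
    IsClosed {x : H | 0 ≤ (inner ℂ (Q x) x).re} :=
  isClosed_le continuous_const (Complex.continuous_re.comp (Q.continuous.inner continuous_id))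

variable [CompleteSpace H]

/-- A consequence of the spectral theorem: the orthogonal complement of some of the eigenspaces is
spanned by the others. -/
theorem mem_closure_eigSpan_compl {S : H →L[ℂ] H} (hc : IsCompactOperator S)
    (hS : (S : H →ₗ[ℂ] H).IsSymmetric) {B : Set ℝ} {x : H} (hx : x ∈ (eigSpan S B)ᗮ) :
    x ∈ (eigSpan S Bᶜ).topologicalClosure := by
  have hBB : eigSpan S Bᶜ ≤ (eigSpan S B)ᗮ := by
    refine eigSpan_le fun μ hμ => ?_
    refine (Submodule.le_orthogonal_orthogonal _).trans (Submodule.orthogonal_le ?_)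
    refine eigSpan_le fun ν hν y hy => ?_
    rw [Submodule.mem_orthogonal]
    intro z hz
    have hne : (μ : ℂ) ≠ (ν : ℂ) := by
      rw [Ne, Complex.ofReal_inj]; rintro rfl; exact hμ hν
    exact hS.orthogonalFamily_eigenspaces hne ⟨z, hz⟩ ⟨y, hy⟩
  have hK : (eigSpan S Bᶜ).topologicalClosure ≤ (eigSpan S B)ᗮ :=
    Submodule.topologicalClosure_minimal _ hBB (Submodule.isClosed_orthogonal _)
  obtain ⟨p, hp, r, hr, rfl⟩ :=
    Submodule.exists_add_mem_mem_orthogonal (K := (eigSpan S Bᶜ).topologicalClosure) x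
  rw [Submodule.orthogonal_closure] at hr
  have hr' : r ∈ (eigSpan S B)ᗮ := by simpa using Submodule.sub_mem _ hx (hK hp)
  have hle : (⨆ z, Module.End.eigenspace (S : H →ₗ[ℂ] H) z) ≤ eigSpan S B ⊔ eigSpan S Bᶜ := by
    refine iSup_le fun z => ?_
    by_cases hz : Module.End.HasEigenvalue (S : H →ₗ[ℂ] H) z
    · obtain ⟨μ, rfl⟩ := Complex.conj_eq_iff_real.1 (hS.conj_eigenvalue_eq_self hz)
      by_cases hμ : μ ∈ B
      · exact (eigenspace_le_eigSpan S hμ).trans le_sup_left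
      · exact (eigenspace_le_eigSpan S (B := Bᶜ) hμ).trans le_sup_right
    · rw [Module.End.hasEigenvalue_iff, not_not] at hz
      rw [hz]; exact bot_le
  have hr0 : r ∈ (⨆ z, Module.End.eigenspace (S : H →ₗ[ℂ] H) z)ᗮ := by
    refine Submodule.orthogonal_le hle ?_
    rw [← Submodule.inf_orthogonal]
    exact ⟨hr', hr⟩
  rw [ContinuousLinearMap.orthogonalComplement_iSup_eigenspaces_eq_bot hc hS,
    Submodule.mem_bot] at hr0
  rw [hr0, add_zero]
  exact hp

/-- The counterpart of `re_inner_nonneg_of_mem_eigSpan` on the orthogonal complement, which by the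
spectral theorem is spanned by the remaining eigenspaces. -/
theorem re_inner_nonneg_of_mem_orthogonal {S Q : H →L[ℂ] H} (hc : IsCompactOperator S)
    (hS : (S : H →ₗ[ℂ] H).IsSymmetric)
    {q : ℝ → ℝ} (hQ : ∀ (μ : ℝ) (x : H), S x = (μ : ℂ) • x → Q x = (q μ : ℂ) • x) {B : Set ℝ}
    (hq : ∀ μ ∉ B, Module.End.eigenspace (S : H →ₗ[ℂ] H) (μ : ℂ) ≠ ⊥ → 0 ≤ q μ) {x : H}
    (hx : x ∈ (eigSpan S B)ᗮ) : 0 ≤ (inner ℂ (Q x) x).re :=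
  closure_minimal (fun _ hy => re_inner_nonneg_of_mem_eigSpan hS hQ hq hy)
    (isClosed_setOf_re_inner_nonneg Q) (mem_closure_eigSpan_compl hc hS hx)

/-- `S` is bounded from below on the closure of this span, hence the compactness of `S` makes
the identity of that closure compact. -/
theorem finiteDimensional_eigSpan {S : H →L[ℂ] H} (hc : IsCompactOperator S)
    (hS : (S : H →ₗ[ℂ] H).IsSymmetric) {κ : ℝ} (hκ : 0 < κ) :
    FiniteDimensional ℂ (eigSpan S (Set.Ici κ)) := by
  let K := (eigSpan S (Set.Ici κ)).topologicalClosure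
  have hbound : ∀ x ∈ K, κ * ‖x‖ ≤ ‖S x‖ := by
    intro x hx
    -- the form of `Q` at `x` is `‖S x‖ ^ 2 - κ ^ 2 * ‖x‖ ^ 2`
    let Q : H →L[ℂ] H := S ∘L S - ((κ ^ 2 : ℝ) : ℂ) • ContinuousLinearMap.id ℂ H
    have h0 : 0 ≤ (inner ℂ (Q x) x).re :=
      closure_minimal (fun _ hy => re_inner_nonneg_of_mem_eigSpan hS (Q := Q)
        (q := fun μ => μ ^ 2 - κ ^ 2) (fun μ y hy => by
          simp only [Q, sub_apply, ContinuousLinearMap.comp_apply, smul_apply,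
            ContinuousLinearMap.id_apply, hy, map_smul, smul_smul, ← sub_smul]
          push_cast; ring_nf)
        (fun μ hμ _ => by
          have : κ ≤ μ := hμ
          nlinarith) hy)
        (isClosed_setOf_re_inner_nonneg Q) hx
    have h1 : inner ℂ (Q x) x = inner ℂ (S x) (S x) - ((κ ^ 2 : ℝ) : ℂ) * inner ℂ x x := by
      have hs : inner ℂ (S (S x)) x = inner ℂ (S x) (S x) := hS (S x) x
      simp only [Q, sub_apply, ContinuousLinearMap.comp_apply, inner_sub_left,
        smul_apply, ContinuousLinearMap.id_apply, inner_smul_left,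
        Complex.conj_ofReal, hs]
    rw [h1, Complex.sub_re, Complex.re_ofReal_mul] at h0
    have h2 : (inner ℂ x x : ℂ).re = ‖x‖ ^ 2 := inner_self_eq_norm_sq (𝕜 := ℂ) x
    have h3 : (inner ℂ (S x) (S x) : ℂ).re = ‖S x‖ ^ 2 := inner_self_eq_norm_sq (𝕜 := ℂ) (S x)
    rw [h2, h3] at h0
    exact abs_le_of_sq_le_sq' (by nlinarith) (norm_nonneg _) |>.2
  have hKc : CompleteSpace K := (Submodule.isClosed_topologicalClosure _).completeSpace_coe
  have hKfin : FiniteDimensional ℂ K := by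
    refine FiniteDimensional.of_isCompactOperator_id ?_
    let g : K →L[ℂ] H := S ∘L K.subtypeL
    have hg : IsCompactOperator g := hc.comp_clm K.subtypeL
    obtain ⟨C, hC, hC0⟩ := hg
    have hanti : AntilipschitzWith (Real.toNNReal κ⁻¹) g := by
      refine g.antilipschitz_of_bound fun x => ?_
      rw [Real.coe_toNNReal _ (inv_nonneg.2 hκ.le), inv_mul_eq_div, le_div_iff₀ hκ, mul_comm]
      exact hbound x x.2
    exact ⟨g ⁻¹' C, (hanti.isClosedEmbedding g.uniformContinuous).isCompact_preimage hC, hC0⟩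
  exact Submodule.finiteDimensional_of_le (Submodule.le_topologicalClosure _)

theorem finiteDimensional_eigSpan_Ioi {S : H →L[ℂ] H} (hc : IsCompactOperator S)
    (hS : (S : H →ₗ[ℂ] H).IsSymmetric) {κ : ℝ} (hκ : 0 < κ) :
    FiniteDimensional ℂ (eigSpan S (Set.Ioi κ)) := by
  have := finiteDimensional_eigSpan hc hS hκ
  exact Submodule.finiteDimensional_of_le
    (eigSpan_mono_of_ne_bot (B' := Set.Ici κ) fun μ (hμ : κ < μ) _ => hμ.le)

/-- Positive eigenvalues do not accumulate at a positive `κ`. -/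
theorem exists_gap {S : H →L[ℂ] H} (hc : IsCompactOperator S)
    (hS : (S : H →ₗ[ℂ] H).IsSymmetric) {κ : ℝ} (hκ : 0 < κ) :
    ∃ δ > 0, δ < κ ∧ eigSpan S (Set.Ioi κ) ≤ eigSpan S (Set.Ici (κ + δ)) ∧
      eigSpan S (Set.Ioi (κ - δ)) ≤ eigSpan S (Set.Ici κ) := by
  have hind : iSupIndep fun μ : ℝ => Module.End.eigenspace (S : H →ₗ[ℂ] H) (μ : ℂ) :=
    (Module.End.eigenspaces_iSupIndep (S : H →ₗ[ℂ] H)).comp Complex.ofReal_injective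
  have hfd := finiteDimensional_eigSpan hc hS (half_pos hκ)
  rw [eigSpan, iSup_subtype] at hfd
  -- only finitely many eigenvalues are at least `κ / 2`
  have hfin := (finite_setOf_ne_bot hind (Set.Ici (κ / 2))).subset
    (Set.sdiff_subset (t := {κ}))
  obtain ⟨ε, hε, hball⟩ := Metric.isOpen_iff.1 hfin.isClosed.isOpen_compl κ (by simp)
  have hgap : ∀ μ, |μ - κ| < min ε (κ / 2) → μ ≠ κ →
      Module.End.eigenspace (S : H →ₗ[ℂ] H) (μ : ℂ) = ⊥ := by
    intro μ hμ hne
    by_contra hb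
    have h1 := (abs_lt.1 (hμ.trans_le (min_le_right _ _))).1
    refine hball (a := μ) ?_ ⟨⟨?_, hb⟩, hne⟩
    · rw [Metric.mem_ball, Real.dist_eq]; exact hμ.trans_le (min_le_left _ _)
    · rw [Set.mem_Ici]; linarith
  have hδ : 0 < min ε (κ / 2) := lt_min hε (half_pos hκ)
  have hδ' : min ε (κ / 2) < κ := (min_le_right _ _).trans_lt (half_lt_self hκ)
  refine ⟨_, hδ, hδ', eigSpan_mono_of_ne_bot fun μ hμ hb => ?_,
    eigSpan_mono_of_ne_bot fun μ hμ hb => ?_⟩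
  all_goals
    by_contra hnot
    simp only [Set.mem_Ici, Set.mem_Ioi, not_le] at hμ hnot
    refine hb (hgap μ (abs_lt.2 ⟨by linarith, by linarith⟩) ?_)
    rintro rfl
    linarith

/-- A quantitative form of the stability of the number of eigenvalues above a threshold. -/
theorem finrank_eigSpan_le {S T : H →L[ℂ] H} (hS : (S : H →ₗ[ℂ] H).IsSymmetric)
    (hTc : IsCompactOperator T) (hT : (T : H →ₗ[ℂ] H).IsSymmetric) {a b : ℝ} (ha : 0 < a)
    (hST : ‖S - T‖ < b - a) :
    Module.finrank ℂ (eigSpan S (Set.Ici b)) ≤ Module.finrank ℂ (eigSpan T (Set.Ioi a)) := by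
  have := finiteDimensional_eigSpan_Ioi hTc hT ha
  refine finrank_le_of_disjoint_orthogonal _ _ fun x hx hx' => ?_
  have h1 := re_inner_nonneg_of_mem_eigSpan hS (Q := S - (b : ℂ) • ContinuousLinearMap.id ℂ H)
    (q := fun μ => μ - b) (fun μ y hy => by simp [hy, sub_smul])
    (fun μ hμ _ => sub_nonneg.2 hμ) hx
  have h2 := re_inner_nonneg_of_mem_orthogonal hTc hT
    (Q := (a : ℂ) • ContinuousLinearMap.id ℂ H - T)
    (q := fun μ => a - μ) (fun μ y hy => by simp [hy, sub_smul])
    (fun μ hμ _ => sub_nonneg.2 (not_lt.1 hμ)) hx'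
  have h3 : (inner ℂ ((S - T) x) x).re ≤ ‖S - T‖ * ‖x‖ ^ 2 :=
    calc (inner ℂ ((S - T) x) x).re ≤ ‖(S - T) x‖ * ‖x‖ := re_inner_le_norm (𝕜 := ℂ) _ _
      _ ≤ ‖S - T‖ * ‖x‖ * ‖x‖ := by gcongr; exact (S - T).le_opNorm x
      _ = ‖S - T‖ * ‖x‖ ^ 2 := by ring
  have h4 : (inner ℂ x x : ℂ).re = ‖x‖ ^ 2 := inner_self_eq_norm_sq (𝕜 := ℂ) x
  simp only [sub_apply, inner_sub_left,
    smul_apply, ContinuousLinearMap.id_apply, inner_smul_left,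
    Complex.conj_ofReal, Complex.sub_re, Complex.re_ofReal_mul, h4] at h1 h2 h3
  by_contra hne
  have : 0 < ‖x‖ ^ 2 := by positivity
  nlinarith

end Compact

/-! ### Resolvents of semibounded self-adjoint operators -/

section Resolvent

variable {H : Type*} [NormedAddCommGroup H] [InnerProductSpace ℂ H]

theorem mem_eigenspace_iff {A : H →ₗ.[ℂ] H} {z : ℂ} {x : H} :
    x ∈ eigenspace A z ↔ ∃ h : x ∈ A.domain, A ⟨x, h⟩ = z • x := by
  constructor
  · rintro ⟨y, hy, rfl⟩
    exact ⟨y.2, sub_eq_zero.1 (show A y - z • (y : H) = 0 from hy)⟩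
  · rintro ⟨h, hx⟩
    exact ⟨⟨x, h⟩, show A ⟨x, h⟩ - z • x = 0 from sub_eq_zero.2 hx, rfl⟩

theorem inner_apply_left {A : H →ₗ.[ℂ] H} [CompleteSpace H] (hA : IsSelfAdjoint A)
    (x y : A.domain) : (inner ℂ (A x) (y : H) : ℂ) = inner ℂ (x : H) (A y) := by
  have h : A.adjoint.IsFormalAdjoint A := LinearPMap.adjoint_isFormalAdjoint hA.dense_domain
  rw [LinearPMap.isSelfAdjoint_def.1 hA] at h
  exact h x y

namespace IsResolventAt

variable {A : H →ₗ.[ℂ] H} {z : ℂ} {R : H →L[ℂ] H}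

theorem mem_domain (h : IsResolventAt A z R) (x : H) : R x ∈ A.domain := by
  obtain ⟨y, hy, -⟩ := h.1 x
  rw [← hy]; exact y.2

theorem apply_sub (h : IsResolventAt A z R) (x : H) (hx : R x ∈ A.domain) :
    A ⟨R x, hx⟩ = x + z • R x := by
  obtain ⟨⟨y, hyd⟩, hy, hy'⟩ := h.1 x
  obtain rfl : y = R x := hy
  exact sub_eq_iff_eq_add.1 hy'

theorem exists_eq (h : IsResolventAt A z R) (y : A.domain) : ∃ x, R x = y := ⟨_, h.2 y⟩

theorem injective (h : IsResolventAt A z R) : Function.Injective R := by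
  rw [injective_iff_map_eq_zero]
  intro x hx
  have h1 := h.apply_sub x (h.mem_domain x)
  have h2 : (⟨R x, h.mem_domain x⟩ : A.domain) = 0 := Subtype.ext hx
  rw [h2, LinearPMap.map_zero, hx, smul_zero, add_zero] at h1
  exact h1.symm

/-- The first resolvent identity. -/
theorem sub_eq {w : ℂ} {S : H →L[ℂ] H} (h : IsResolventAt A z R) (h' : IsResolventAt A w S) :
    S - R = (w - z) • (R ∘L S) := by
  ext x
  have h1 := h.2 ⟨S x, h'.mem_domain x⟩
  rw [h'.apply_sub] at h1
  have h2 : x + w • S x - z • S x = x + (w - z) • S x := by module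
  change R (x + w • S x - z • S x) = S x at h1
  rw [h2, map_add, map_smul] at h1
  change S x - R x = (w - z) • R (S x)
  exact sub_eq_of_eq_add' h1.symm

/-- The eigenspaces of `A` are those of its resolvent. For `t = c` both are trivial, in accordance
with the convention `0⁻¹ = 0`. -/
theorem eigenspace_eq {c : ℝ} {S : H →L[ℂ] H} (h : IsResolventAt A (c : ℂ) S) (t : ℝ) :
    eigenspace A (t : ℂ) = Module.End.eigenspace (S : H →ₗ[ℂ] H) (((t - c)⁻¹ : ℝ) : ℂ) := by
  ext x
  rw [mem_eigenspace_iff, mem_eigenspace_clm]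
  rcases eq_or_ne t c with rfl | hne
  · rw [sub_self, inv_zero, Complex.ofReal_zero, zero_smul]
    constructor
    · rintro ⟨hx, hAx⟩
      have h1 := h.2 ⟨x, hx⟩
      rw [hAx, sub_self, map_zero] at h1
      obtain rfl : 0 = x := h1
      exact map_zero S
    · intro hx
      obtain rfl : x = 0 := h.injective (by rw [hx, map_zero])
      exact ⟨A.domain.zero_mem, by rw [smul_zero]; exact A.map_zero⟩
  · have hne' : (t : ℂ) - c ≠ 0 := by
      rw [← Complex.ofReal_sub]; exact Complex.ofReal_ne_zero.2 (sub_ne_zero.2 hne)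
    push_cast
    constructor
    · rintro ⟨hx, hAx⟩
      have h1 : S (A ⟨x, hx⟩ - (c : ℂ) • x) = x := h.2 ⟨x, hx⟩
      rw [hAx, ← sub_smul, map_smul] at h1
      rw [eq_inv_smul_iff₀ hne', h1]
    · intro hx
      have hx' : x = S (((t : ℂ) - c) • x) := by
        rw [map_smul, hx, smul_smul, mul_inv_cancel₀ hne', one_smul]
      have hd : x ∈ A.domain := by rw [hx']; exact h.mem_domain _
      refine ⟨hd, ?_⟩
      have h1 := h.apply_sub (((t : ℂ) - c) • x) (h.mem_domain _)
      have h2 : (⟨x, hd⟩ : A.domain) = ⟨S (((t : ℂ) - c) • x), h.mem_domain _⟩ := Subtype.ext hx'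
      rw [h2, h1, ← hx']
      module

theorem isSymmetric [CompleteSpace H] {c : ℝ} {S : H →L[ℂ] H} (h : IsResolventAt A (c : ℂ) S)
    (hA : IsSelfAdjoint A) : (S : H →ₗ[ℂ] H).IsSymmetric := by
  intro x y
  have h1 := inner_apply_left hA ⟨S x, h.mem_domain x⟩ ⟨S y, h.mem_domain y⟩
  rw [h.apply_sub, h.apply_sub] at h1
  simp only [inner_add_left, inner_add_right, inner_smul_left, inner_smul_right,
    Complex.conj_ofReal] at h1
  exact (add_right_cancel h1).symm

end IsResolventAt

theorem HasCompactResolvent.isCompactOperator {A : H →ₗ.[ℂ] H} (hA : HasCompactResolvent A)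
    {w : ℂ} {S : H →L[ℂ] H} (hS : IsResolventAt A w S) : IsCompactOperator S := by
  obtain ⟨z, R, hR, hRc⟩ := hA
  have h1 : S = R + R ∘L ((w - z) • S) := by
    rw [ContinuousLinearMap.comp_smul, ← hR.sub_eq hS]; abel
  rw [h1]
  exact hRc.add (hRc.comp_clm ((w - z) • S))

theorem IsBoundedBelowBy.eigenspace_eq_bot {A : H →ₗ.[ℂ] H} {μ : ℝ} (h : IsBoundedBelowBy A μ)
    {t : ℝ} (ht : t < μ) : eigenspace A (t : ℂ) = ⊥ := by
  rw [Submodule.eq_bot_iff]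
  intro x hx
  obtain ⟨hd, hx⟩ := mem_eigenspace_iff.1 hx
  have h1 : μ * ‖x‖ ^ 2 ≤ (inner ℂ (A ⟨x, hd⟩) x).re := h ⟨x, hd⟩
  have h2 : (inner ℂ x x : ℂ).re = ‖x‖ ^ 2 := inner_self_eq_norm_sq (𝕜 := ℂ) x
  rw [hx, inner_smul_left, Complex.conj_ofReal, Complex.re_ofReal_mul, h2] at h1
  by_contra hne
  have : 0 < ‖x‖ ^ 2 := by positivity
  nlinarith

/-- The resolvent at a point `c` below the spectrum, expressed through the resolvent `R` at `i`
as `R (1 - (c - i) R)⁻¹`. -/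
noncomputable def shiftedResolvent (R : H →L[ℂ] H) (c : ℝ) : H →L[ℂ] H :=
  R * Ring.inverse (1 - ((c : ℂ) - Complex.I) • R)

/-- By the Fredholm alternative it is enough that the operator is injective, and a vector of its
kernel would be an eigenvector of `A` for the eigenvalue `c`. -/
theorem isUnit_one_sub_smul [CompleteSpace H] {A : H →ₗ.[ℂ] H} (hA : HasCompactResolvent A) {μ : ℝ}
    (hμ : IsBoundedBelowBy A μ) {R : H →L[ℂ] H} (hR : IsResolventAt A Complex.I R) {c : ℝ}
    (hc : c < μ) : IsUnit (1 - ((c : ℂ) - Complex.I) • R) := by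
  have hw : (c : ℂ) - Complex.I ≠ 0 := by
    intro h
    have := congrArg Complex.im h
    simp at this
  set w := (c : ℂ) - Complex.I with hwdef
  rcases (hA.isCompactOperator hR).hasEigenvalue_or_mem_resolventSet (inv_ne_zero hw) with h | h
  · obtain ⟨x, hx, hx0⟩ := h.exists_hasEigenvector
    refine absurd ?_ hx0
    have hx : R x = w⁻¹ • x := mem_eigenspace_clm.1 hx
    have hmem : R x ∈ eigenspace A (c : ℂ) := by
      refine mem_eigenspace_iff.2 ⟨hR.mem_domain x, ?_⟩
      have h2 : x = w • R x := by rw [hx, smul_inv_smul₀ hw]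
      rw [hR.apply_sub, ← sub_eq_zero]
      nth_rewrite 1 [h2]
      rw [hwdef]
      module
    rw [hμ.eigenspace_eq_bot hc, Submodule.mem_bot] at hmem
    exact hR.injective (by rw [hmem, map_zero])
  · rw [spectrum.mem_resolventSet_iff] at h
    have h1 : 1 - w • R = (Units.mk0 w hw) • (algebraMap ℂ (H →L[ℂ] H) w⁻¹ - R) := by
      rw [Algebra.algebraMap_eq_smul_one, Units.smul_def, Units.val_mk0, smul_sub, smul_smul,
        mul_inv_cancel₀ hw, one_smul]
    rw [h1]
    exact h.smul _

theorem isResolventAt_shiftedResolvent {A : H →ₗ.[ℂ] H} {R : H →L[ℂ] H}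
    (hR : IsResolventAt A Complex.I R) {c : ℝ} (hu : IsUnit (1 - ((c : ℂ) - Complex.I) • R)) :
    IsResolventAt A (c : ℂ) (shiftedResolvent R c) := by
  set w := (c : ℂ) - Complex.I with hw
  have hr : ∀ x, Ring.inverse (1 - w • R) x - w • R (Ring.inverse (1 - w • R) x) = x := fun x => by
    simpa using congrArg (fun B : H →L[ℂ] H => B x) (Ring.mul_inverse_cancel _ hu)
  have hl : ∀ x, Ring.inverse (1 - w • R) (x - w • R x) = x := fun x => by
    simpa using congrArg (fun B : H →L[ℂ] H => B x) (Ring.inverse_mul_cancel _ hu)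
  refine ⟨fun x => ?_, fun y => ?_⟩
  · refine ⟨⟨_, hR.mem_domain (Ring.inverse (1 - w • R) x)⟩, rfl, ?_⟩
    rw [hR.apply_sub]
    refine Eq.trans ?_ (hr x)
    rw [hw]
    module
  · change R (Ring.inverse (1 - w • R) (A y - (c : ℂ) • (y : H))) = y
    have h1 : A y - (c : ℂ) • (y : H) =
        (A y - Complex.I • (y : H)) - w • R (A y - Complex.I • (y : H)) := by
      rw [hR.2 y, hw]; module
    rw [h1, hl, hR.2 y]

/-! ### The negative and the nonpositive spectral subspace -/

/-- The span of the eigenspaces of `A` for negative eigenvalues. -/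
noncomputable def negSpan (A : H →ₗ.[ℂ] H) : Submodule ℂ H :=
  ⨆ t ∈ Set.Iio (0 : ℝ), eigenspace A (t : ℂ)

/-- The span of the eigenspaces of `A` for nonpositive eigenvalues. -/
noncomputable def nonposSpan (A : H →ₗ.[ℂ] H) : Submodule ℂ H :=
  ⨆ t ∈ Set.Iic (0 : ℝ), eigenspace A (t : ℂ)

theorem nonposSpan_eq_sup (A : H →ₗ.[ℂ] H) : nonposSpan A = eigenspace A 0 ⊔ negSpan A := by
  rw [nonposSpan, ← Set.Iio_insert, iSup_insert, Complex.ofReal_zero, negSpan]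

/-- A semibounded self-adjoint operator `A` with a compact resolvent `S = (A - c)⁻¹` at a negative
point `c` below its lower bound `μ`. -/
structure IsCompactResolventBelow (A : H →ₗ.[ℂ] H) (μ c : ℝ) (S : H →L[ℂ] H) : Prop where
  lower : IsBoundedBelowBy A μ
  lt_lower : c < μ
  neg : c < 0
  resolvent : IsResolventAt A (c : ℂ) S
  compact : IsCompactOperator S
  symmetric : (S : H →ₗ[ℂ] H).IsSymmetric

namespace IsCompactResolventBelow

variable {A : H →ₗ.[ℂ] H} {μ c : ℝ} {S : H →L[ℂ] H}

theorem threshold_pos (h : IsCompactResolventBelow A μ c S) : 0 < (-c)⁻¹ :=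
  inv_pos.2 (neg_pos.2 h.neg)

/-- `S` is positive. -/
theorem eigenspace_eq_bot (h : IsCompactResolventBelow A μ c S) {ν : ℝ} (hν : ν < 0) :
    Module.End.eigenspace (S : H →ₗ[ℂ] H) (ν : ℂ) = ⊥ := by
  have h1 := h.resolvent.eigenspace_eq (c + ν⁻¹)
  rw [add_sub_cancel_left, inv_inv] at h1
  rw [← h1]
  refine h.lower.eigenspace_eq_bot ?_
  have := inv_lt_zero.2 hν
  linarith [h.lt_lower]

theorem biSup_eigenspace_eq (h : IsCompactResolventBelow A μ c S) {B B' : Set ℝ}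
    (hB' : B' ⊆ Set.Ioi 0)
    (hBB' : ∀ ν > 0, c + ν⁻¹ ∈ B ↔ ν ∈ B') :
    ⨆ t ∈ B, eigenspace A (t : ℂ) = eigSpan S B' := by
  refine le_antisymm (iSup₂_le fun t ht => ?_) (eigSpan_le fun ν hν => ?_)
  · rcases le_or_gt t c with htc | htc
    · rw [h.lower.eigenspace_eq_bot (htc.trans_lt h.lt_lower)]; exact bot_le
    · rw [h.resolvent.eigenspace_eq t]
      refine eigenspace_le_eigSpan S ((hBB' _ (inv_pos.2 (sub_pos.2 htc))).1 ?_)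
      rwa [inv_inv, add_sub_cancel]
  · refine le_iSup₂_of_le (c + ν⁻¹) ((hBB' ν (hB' hν)).2 hν) (le_of_eq ?_)
    rw [h.resolvent.eigenspace_eq, add_sub_cancel_left, inv_inv]

/-- A negative eigenvalue `t` of `A` corresponds to the eigenvalue `(t - c)⁻¹ > (-c)⁻¹` of `S`. -/
theorem negSpan_eq (h : IsCompactResolventBelow A μ c S) :
    negSpan A = eigSpan S (Set.Ioi (-c)⁻¹) := by
  refine h.biSup_eigenspace_eq (fun ν hν => h.threshold_pos.trans hν) fun ν hν => ?_
  rw [Set.mem_Iio, Set.mem_Ioi, inv_lt_comm₀ (neg_pos.2 h.neg) hν]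
  constructor <;> intro h' <;> linarith

theorem nonposSpan_eq (h : IsCompactResolventBelow A μ c S) :
    nonposSpan A = eigSpan S (Set.Ici (-c)⁻¹) := by
  refine h.biSup_eigenspace_eq (fun ν hν => h.threshold_pos.trans_le hν) fun ν hν => ?_
  rw [Set.mem_Iic, Set.mem_Ici, inv_le_comm₀ (neg_pos.2 h.neg) hν]
  constructor <;> intro h' <;> linarith

theorem finiteDimensional_nonposSpan [CompleteSpace H] (h : IsCompactResolventBelow A μ c S) :
    FiniteDimensional ℂ (nonposSpan A) := by
  rw [h.nonposSpan_eq]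
  exact finiteDimensional_eigSpan h.compact h.symmetric h.threshold_pos

theorem finiteDimensional_negSpan [CompleteSpace H] (h : IsCompactResolventBelow A μ c S) :
    FiniteDimensional ℂ (negSpan A) := by
  rw [h.negSpan_eq]
  exact finiteDimensional_eigSpan_Ioi h.compact h.symmetric h.threshold_pos

theorem iSupIndep_eigenspace (h : IsCompactResolventBelow A μ c S) :
    iSupIndep fun t : ℝ => eigenspace A (t : ℂ) := by
  simp_rw [h.resolvent.eigenspace_eq]
  refine (Module.End.eigenspaces_iSupIndep (S : H →ₗ[ℂ] H)).comp
    (f := fun t : ℝ => (((t - c)⁻¹ : ℝ) : ℂ)) fun s t hst => ?_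
  have := inv_injective (Complex.ofReal_injective hst)
  linarith

theorem numNegEigenvalues_eq [CompleteSpace H] (h : IsCompactResolventBelow A μ c S) :
    numNegEigenvalues A = (Module.finrank ℂ (negSpan A) : ℕ∞) := by
  have := h.finiteDimensional_negSpan
  unfold negSpan at this
  exact countOn_rank h.iSupIndep_eigenspace (Set.Iio 0)

theorem multiplicity_zero_eq [CompleteSpace H] (h : IsCompactResolventBelow A μ c S) :
    multiplicity A 0 = (Module.finrank ℂ (eigenspace A 0) : ℕ∞) := by
  have := h.finiteDimensional_nonposSpan
  have : FiniteDimensional ℂ (eigenspace A 0) :=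
    Submodule.finiteDimensional_of_le (nonposSpan_eq_sup A ▸ le_sup_left)
  exact toENat_rank_eq_finrank _

theorem finrank_nonposSpan [CompleteSpace H] (h : IsCompactResolventBelow A μ c S) :
    Module.finrank ℂ (nonposSpan A) =
      Module.finrank ℂ (negSpan A) + Module.finrank ℂ (eigenspace A 0) := by
  have := h.finiteDimensional_nonposSpan
  have := h.finiteDimensional_negSpan
  have : FiniteDimensional ℂ (eigenspace A 0) :=
    Submodule.finiteDimensional_of_le (nonposSpan_eq_sup A ▸ le_sup_left)
  have hd : Disjoint (eigenspace A ((0 : ℝ) : ℂ)) (negSpan A) :=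
    h.iSupIndep_eigenspace.disjoint_biSup (y := Set.Iio (0 : ℝ)) (by simp)
  rw [Complex.ofReal_zero] at hd
  have h1 := Submodule.finrank_sup_add_finrank_inf_eq (eigenspace A 0) (negSpan A)
  rw [hd.eq_bot, finrank_bot, ← nonposSpan_eq_sup] at h1
  omega

/-- The bounded operator whose form at `x` is the form of `A` at `S x`. -/
theorem re_inner_apply (h : IsCompactResolventBelow A μ c S) (x : H) (hx : S x ∈ A.domain) :
    (inner ℂ (A ⟨S x, hx⟩) (S x)).re = (inner ℂ ((S + (c : ℂ) • (S ∘L S)) x) x).re := by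
  have h1 : (inner ℂ x (S x) : ℂ) = inner ℂ (S x) x := (h.symmetric x x).symm
  have h2 : (inner ℂ (S (S x)) x : ℂ) = inner ℂ (S x) (S x) := h.symmetric (S x) x
  rw [h.resolvent.apply_sub]
  simp only [add_apply, smul_apply, ContinuousLinearMap.comp_apply, inner_add_left,
    inner_smul_left, Complex.conj_ofReal, h1, h2]

theorem apply_eigenvector (c : ℝ) (ν : ℝ) (x : H) (hx : S x = (ν : ℂ) • x) :
    (S + (c : ℂ) • (S ∘L S)) x = ((ν + c * ν ^ 2 : ℝ) : ℂ) • x := by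
  simp only [add_apply, smul_apply, ContinuousLinearMap.comp_apply, hx, map_smul, smul_smul,
    ← add_smul]
  push_cast; ring_nf

theorem re_inner_nonpos (h : IsCompactResolventBelow A μ c S) {y : H} (hy : y ∈ nonposSpan A) :
    ∃ hd : y ∈ A.domain, (inner ℂ (A ⟨y, hd⟩) y).re ≤ 0 := by
  rw [h.nonposSpan_eq] at hy
  obtain ⟨x, hx, rfl⟩ := exists_preimage_mem_eigSpan (by simpa using h.threshold_pos) hy
  refine ⟨h.resolvent.mem_domain x, ?_⟩
  rw [h.re_inner_apply]
  have h1 := re_inner_nonneg_of_mem_eigSpan h.symmetric (Q := -(S + (c : ℂ) • (S ∘L S)))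
    (q := fun ν => -(ν + c * ν ^ 2)) (fun ν x hx => by
      rw [neg_apply, apply_eigenvector c ν x hx]; push_cast; module)
    (fun ν hν _ => by
      have hν' : (-c)⁻¹ ≤ ν := hν
      have hν0 := h.threshold_pos.trans_le hν'
      rw [inv_le_iff_one_le_mul₀ (neg_pos.2 h.neg)] at hν'
      nlinarith) hx
  rw [neg_apply, inner_neg_left, Complex.neg_re] at h1
  linarith

/-- The form of `A` splits along `negSpan A` and its orthogonal complement; it is nonnegative on
the latter, and on the former it is estimated by the lower bound of `A`. -/
theorem lower_bound_starProjection [CompleteSpace H] (h : IsCompactResolventBelow A μ c S)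
    [(negSpan A).HasOrthogonalProjection] (y : A.domain) :
    μ * ‖(negSpan A).starProjection (y : H)‖ ^ 2 ≤ (inner ℂ (A y) (y : H)).re := by
  obtain ⟨x, hx⟩ := h.resolvent.exists_eq y
  obtain ⟨y, hyd⟩ := y
  obtain rfl : S x = y := hx
  obtain ⟨p, hp, r, hr, rfl⟩ := Submodule.exists_add_mem_mem_orthogonal (K := negSpan A) x
  have hSN : ∀ v ∈ negSpan A, S v ∈ negSpan A := by
    rw [h.negSpan_eq]; exact fun v hv => map_mem_eigSpan hv
  have hSr : S r ∈ (negSpan A)ᗮ := by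
    rw [Submodule.mem_orthogonal]
    intro u hu
    have h1 : inner ℂ (S u) r = inner ℂ u (S r) := h.symmetric u r
    rw [← h1]
    exact (Submodule.mem_orthogonal _ _).1 hr _ (hSN u hu)
  have hproj : (negSpan A).starProjection (S (p + r)) = S p := by
    rw [map_add]
    exact (Submodule.eq_starProjection_of_mem_orthogonal' (hSN p hp) hSr rfl)
  have hr' := hr
  rw [h.negSpan_eq] at hr'
  have h1 := re_inner_nonneg_of_mem_orthogonal h.compact h.symmetric
    (Q := S + (c : ℂ) • (S ∘L S)) (q := fun ν => ν + c * ν ^ 2)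
    (fun ν x hx => apply_eigenvector c ν x hx) (fun ν hν hb => by
      have hν0 : 0 ≤ ν := not_lt.1 fun h0 => hb (h.eigenspace_eq_bot h0)
      have hν' : ν ≤ (-c)⁻¹ := not_lt.1 hν
      rw [inv_eq_one_div, le_div_iff₀ (neg_pos.2 h.neg)] at hν'
      nlinarith) hr'
  have h2 := h.lower ⟨S p, h.resolvent.mem_domain p⟩
  rw [h.re_inner_apply] at h2
  rw [h.re_inner_apply, hproj]
  set Q := S + (c : ℂ) • (S ∘L S) with hQ
  have hQp : Q p ∈ negSpan A :=
    Submodule.add_mem _ (hSN p hp) (Submodule.smul_mem _ _ (hSN _ (hSN p hp)))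
  have hQs : (inner ℂ (Q r) p : ℂ) = inner ℂ r (Q p) := by
    have e1 : (inner ℂ (S r) p : ℂ) = inner ℂ r (S p) := h.symmetric r p
    have e2 : (inner ℂ (S (S r)) p : ℂ) = inner ℂ r (S (S p)) :=
      (h.symmetric (S r) p).trans (h.symmetric r (S p))
    simp only [hQ, add_apply, smul_apply, ContinuousLinearMap.comp_apply, inner_add_left,
      inner_add_right, inner_smul_left, inner_smul_right, Complex.conj_ofReal, e1, e2]
  rw [map_add, inner_add_left, inner_add_right, inner_add_right, hQs,
    (Submodule.mem_orthogonal _ _).1 hr _ hQp, (Submodule.mem_orthogonal' _ _).1 hr _ hQp]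
  simp only [add_zero, zero_add, Complex.add_re]
  linarith

end IsCompactResolventBelow

end Resolvent

/-! ### Closed forms and the comparison of counting functions -/

section Forms

variable {H : Type*} [NormedAddCommGroup H] [InnerProductSpace ℂ H]

theorem PartialForm.IsClosureOf.quad_eq {A : H →ₗ.[ℂ] H} {𝔠 : PartialForm H}
    (h : 𝔠.IsClosureOf (operatorForm A)) (y : A.domain) :
    ∃ hy : (y : H) ∈ 𝔠.domain, 𝔠.quad ⟨y, hy⟩ = inner ℂ (A y) (y : H) := by
  have hconv : (operatorForm A).Converges (fun _ => y) (y : H) := by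
    refine ⟨tendsto_const_nhds, tendsto_const_nhds.congr fun _ => ?_⟩
    change 0 = (inner ℂ (A (y - y)) ((y - y : A.domain) : H) : ℂ)
    rw [sub_self, ZeroMemClass.coe_zero, inner_zero_right]
  have hy : (y : H) ∈ 𝔠.domain := (h.mem_domain_iff _).2 ⟨_, hconv⟩
  exact ⟨hy, tendsto_nhds_unique (h.tendsto_quad ⟨y, hy⟩ _ hconv) tendsto_const_nhds⟩

variable [CompleteSpace H]

/-- The closed form of `A` inherits from the operator the lower bound by the component in
`negSpan A`, which depends continuously on the vector. -/
theorem PartialForm.IsClosureOf.re_quad_nonneg {A : H →ₗ.[ℂ] H} {μ c : ℝ} {S : H →L[ℂ] H}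
    (hA : IsCompactResolventBelow A μ c S) {𝔠 : PartialForm H}
    (h : 𝔠.IsClosureOf (operatorForm A)) (y : 𝔠.domain) (hy : (y : H) ∈ (negSpan A)ᗮ) :
    0 ≤ (𝔠.quad y).re := by
  have := hA.finiteDimensional_negSpan
  obtain ⟨x, hx⟩ := (h.mem_domain_iff y).1 y.2
  have h1 := (Complex.continuous_re.tendsto _).comp (h.tendsto_quad y x hx)
  have h2 : Tendsto (fun n => μ * ‖(negSpan A).starProjection (x n : H)‖ ^ 2) atTop
      (𝓝 (μ * ‖(negSpan A).starProjection (y : H)‖ ^ 2)) :=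
    ((((negSpan A).starProjection.continuous.tendsto _).comp hx.1).norm.pow 2).const_mul μ
  rw [(Submodule.starProjection_apply_eq_zero_iff _).2 hy] at h2
  simp only [norm_zero, ne_eq, OfNat.ofNat_ne_zero, not_false_eq_true, zero_pow, mul_zero] at h2
  exact le_of_tendsto_of_tendsto' h2 h1 fun n => hA.lower_bound_starProjection (x n)

/-- The form of `B` is negative on the nonzero vectors of `nonposSpan A`, and nonnegative on the
orthogonal complement of `negSpan B`. -/
theorem finrank_nonposSpan_le_finrank_negSpan {A B : H →ₗ.[ℂ] H} {μ c μ' c' : ℝ}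
    {S S' : H →L[ℂ] H} (hA : IsCompactResolventBelow A μ c S)
    (hB : IsCompactResolventBelow B μ' c' S') {𝔞 𝔟 : PartialForm H}
    (ha : 𝔞.IsClosureOf (operatorForm A)) (hb : 𝔟.IsClosureOf (operatorForm B))
    (hdom : 𝔞.domain = 𝔟.domain)
    (hlt : ∀ (y : H) (h₁ : y ∈ 𝔞.domain) (h₂ : y ∈ 𝔟.domain), y ≠ 0 →
      0 < (𝔞.quad ⟨y, h₁⟩).re - (𝔟.quad ⟨y, h₂⟩).re) :
    Module.finrank ℂ (nonposSpan A) ≤ Module.finrank ℂ (negSpan B) := by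
  have := hB.finiteDimensional_negSpan
  refine finrank_le_of_disjoint_orthogonal _ _ fun y hy hy' => ?_
  obtain ⟨hd, hneg⟩ := hA.re_inner_nonpos hy
  obtain ⟨hya, hq⟩ := ha.quad_eq ⟨y, hd⟩
  have hyb : y ∈ 𝔟.domain := hdom ▸ hya
  have h1 := hb.re_quad_nonneg hB ⟨y, hyb⟩ hy'
  by_contra hne
  have h2 := hlt y hya hyb hne
  rw [hq] at h2
  linarith

end Forms

/-! ### Dependence on the parameter -/

section Family

variable {H : Type*} [NormedAddCommGroup H] [InnerProductSpace ℂ H] [CompleteSpace H]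

theorem isOpen_openInterval (σ τ : EReal) : IsOpen (openInterval σ τ) :=
  (isOpen_lt continuous_const continuous_coe_real_ereal).inter
    (isOpen_lt continuous_coe_real_ereal continuous_const)

theorem ordConnected_openInterval (σ τ : EReal) : (openInterval σ τ).OrdConnected :=
  ⟨fun _ hx _ hy _ hz => ⟨hx.1.trans_le (EReal.coe_le_coe_iff.2 hz.1),
    (EReal.coe_le_coe_iff.2 hz.2).trans_lt hy.2⟩⟩

variable {σ τ : EReal} {F : ℝ → H →ₗ.[ℂ] H}

/-- Near every `t` the resolvents of all `F s` at one common real point `c` exist, and they depend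
continuously on `s` at `t`. -/
theorem IsAdmissible.exists_resolventBelow (hF : IsAdmissible σ τ F) {t : ℝ}
    (ht : t ∈ openInterval σ τ) : ∃ (μ c : ℝ) (S : ℝ → H →L[ℂ] H),
      (∀ᶠ s in 𝓝 t, IsCompactResolventBelow (F s) μ c (S s)) ∧ ContinuousAt S t := by
  obtain ⟨R, hR, hRc⟩ := hF.continuousResolvent
  obtain ⟨μ, hμ⟩ := hF.locallyBoundedBelow t ht
  have hc : min μ 0 - 1 < μ := by linarith [min_le_left μ 0]
  have hc0 : min μ 0 - 1 < 0 := by linarith [min_le_right μ 0]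
  set c := min μ 0 - 1
  have hopen := (isOpen_openInterval σ τ).mem_nhds ht
  refine ⟨μ, c, fun s => shiftedResolvent (R s) c, ?_, ?_⟩
  · filter_upwards [hμ, hopen] with s hs hsI
    have hres := isResolventAt_shiftedResolvent (hR s hsI)
      (isUnit_one_sub_smul (hF.compactResolvent s hsI) hs (hR s hsI) hc)
    exact ⟨hs, hc, hc0, hres, (hF.compactResolvent s hsI).isCompactOperator hres,
      hres.isSymmetric (hF.selfAdjoint s hsI)⟩
  · have hRt : ContinuousAt R t := hRc.continuousAt hopen
    have hu := isUnit_one_sub_smul (hF.compactResolvent t ht) hμ.self_of_nhds (hR t ht) hc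
    have hinv : ContinuousAt Ring.inverse (1 - ((c : ℂ) - Complex.I) • R t) := by
      obtain ⟨u, hu⟩ := hu
      rw [← hu]; exact NormedRing.inverse_continuousAt u
    exact hRt.mul (ContinuousAt.comp (f := fun s => 1 - ((c : ℂ) - Complex.I) • R s) hinv
      (continuousAt_const.sub (hRt.const_smul ((c : ℂ) - Complex.I))))

/-- The dimension of the negative subspace is lower semicontinuous in the parameter, that of the
nonpositive subspace is upper semicontinuous. -/
theorem IsAdmissible.eventually_finrank_le (hF : IsAdmissible σ τ F) {t : ℝ}
    (ht : t ∈ openInterval σ τ) : ∀ᶠ s in 𝓝 t,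
      Module.finrank ℂ (negSpan (F t)) ≤ Module.finrank ℂ (negSpan (F s)) ∧
      Module.finrank ℂ (nonposSpan (F s)) ≤ Module.finrank ℂ (nonposSpan (F t)) := by
  obtain ⟨μ, c, S, hS, hcont⟩ := hF.exists_resolventBelow ht
  have hSt := hS.self_of_nhds
  obtain ⟨δ, hδ, hδκ, hgap, hgap'⟩ := exists_gap hSt.compact hSt.symmetric hSt.threshold_pos
  filter_upwards [hS, Metric.continuousAt_iff'.1 hcont δ hδ] with s hs hdist
  rw [dist_eq_norm] at hdist
  have hfin := hSt.finiteDimensional_nonposSpan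
  rw [hSt.nonposSpan_eq] at hfin
  have hfin' := finiteDimensional_eigSpan hSt.compact hSt.symmetric
    (hSt.threshold_pos.trans (lt_add_of_pos_right _ hδ))
  rw [hSt.negSpan_eq, hs.negSpan_eq, hSt.nonposSpan_eq, hs.nonposSpan_eq]
  constructor
  · refine (Submodule.finrank_mono hgap).trans
      (finrank_eigSpan_le hSt.symmetric hs.compact hs.symmetric hs.threshold_pos ?_)
    rwa [norm_sub_rev, add_sub_cancel_left]
  · refine (finrank_eigSpan_le hs.symmetric hSt.compact hSt.symmetric (sub_pos.2 hδκ) ?_).trans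
      (Submodule.finrank_mono hgap')
    rwa [sub_sub_cancel]

end Family

/-! ### The counting formula -/

end SpectralCount

open SpectralCount in
theorem mainTheorem2 {H : Type*} [NormedAddCommGroup H] [InnerProductSpace ℂ H] [CompleteSpace H]
    (σ τ : EReal) (F : ℝ → H →ₗ.[ℂ] H) (hF : SpectralCount.IsAdmissible σ τ F)
    (f : ℝ → SpectralCount.PartialForm H) (D : Submodule ℂ H)
    (hf : ∀ t ∈ SpectralCount.openInterval σ τ,
      (f t).IsClosureOf (SpectralCount.operatorForm (F t)))
    (hD : ∀ t ∈ SpectralCount.openInterval σ τ, (f t).domain = D)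
    (hdec : ∀ t₁ ∈ SpectralCount.openInterval σ τ, ∀ t₂ ∈ SpectralCount.openInterval σ τ, t₁ < t₂ →
      ∀ (y : H) (h₁ : y ∈ (f t₁).domain) (h₂ : y ∈ (f t₂).domain), y ≠ 0 →
        0 < ((f t₁).quad ⟨y, h₁⟩).re - ((f t₂).quad ⟨y, h₂⟩).re)
    (ξ₁ ξ₂ : ℝ) (hξ₁ : ξ₁ ∈ SpectralCount.openInterval σ τ)
    (hξ₂ : ξ₂ ∈ SpectralCount.openInterval σ τ) (hξ : ξ₁ < ξ₂) :
    SpectralCount.numEigenvaluesIco F ξ₁ ξ₂ ≠ ⊤ ∧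
      SpectralCount.numNegEigenvalues (F ξ₁) ≠ ⊤ ∧
      SpectralCount.numNegEigenvalues (F ξ₂) ≠ ⊤ ∧
      ((SpectralCount.numEigenvaluesIco F ξ₁ ξ₂).toNat : ℤ) =
        (SpectralCount.numNegEigenvalues (F ξ₂)).toNat -
          (SpectralCount.numNegEigenvalues (F ξ₁)).toNat := by
  let n : ℝ → ℕ := fun t => Module.finrank ℂ (negSpan (F t))
  let m : ℝ → ℕ := fun t => Module.finrank ℂ (eigenspace (F t) 0)
  have hsub : Set.Icc ξ₁ ξ₂ ⊆ openInterval σ τ := (ordConnected_openInterval σ τ).out hξ₁ hξ₂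
  have hres : ∀ t ∈ openInterval σ τ, ∃ (μ c : ℝ) (S : H →L[ℂ] H),
      IsCompactResolventBelow (F t) μ c S := fun t ht => by
    obtain ⟨μ, c, S, hS, -⟩ := hF.exists_resolventBelow ht
    exact ⟨μ, c, S t, hS.self_of_nhds⟩
  have hnonpos : ∀ t ∈ openInterval σ τ,
      Module.finrank ℂ (nonposSpan (F t)) = n t + m t := fun t ht => by
    obtain ⟨μ, c, S, hS⟩ := hres t ht
    exact hS.finrank_nonposSpan
  have hneg : ∀ t ∈ openInterval σ τ, numNegEigenvalues (F t) = (n t : ℕ∞) := fun t ht => by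
    obtain ⟨μ, c, S, hS⟩ := hres t ht
    exact hS.numNegEigenvalues_eq
  have hmult : ∀ t ∈ openInterval σ τ, multiplicity (F t) 0 = (m t : ℕ∞) := fun t ht => by
    obtain ⟨μ, c, S, hS⟩ := hres t ht
    exact hS.multiplicity_zero_eq
  have hmono : ∀ s ∈ openInterval σ τ, ∀ t ∈ openInterval σ τ, s < t → n s + m s ≤ n t :=
    fun s hs t ht hst => by
      obtain ⟨μ, c, S, hS⟩ := hres s hs
      obtain ⟨μ', c', S', hS'⟩ := hres t ht
      rw [← hnonpos s hs]
      exact finrank_nonposSpan_le_finrank_negSpan hS hS' (hf s hs) (hf t ht)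
        ((hD s hs).trans (hD t ht).symm) (hdec s hs t ht hst)
  -- near `t` semicontinuity turns the inequalities of monotonicity into equalities
  have hloc : ∀ t ∈ Set.Icc ξ₁ ξ₂, ∀ᶠ s in 𝓝 t, (s < t → m s = 0 ∧ n s = n t) ∧
      (t < s → m s = 0 ∧ n s = n t + m t) := fun t htI => by
    have ht := hsub htI
    filter_upwards [hF.eventually_finrank_le ht, (isOpen_openInterval σ τ).mem_nhds ht]
      with s hs hsI
    rw [hnonpos s hsI, hnonpos t ht] at hs
    change n t ≤ n s ∧ _ at hs
    refine ⟨fun hst => ?_, fun hts => ?_⟩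
    · have := hmono s hsI t ht hst
      omega
    · have := hmono t ht s hsI hts
      omega
  obtain ⟨E, hE, hE0, hsum⟩ := exists_finset_sum_jumps hξ.le
    (fun t ht => (hloc t ht).mono fun _ h => h.1) (fun t ht => (hloc t ht).mono fun _ h => h.2)
  have hcount : numEigenvaluesIco F ξ₁ ξ₂ = ((∑ t ∈ E, m t : ℕ) : ℕ∞) := by
    rw [numEigenvaluesIco, countOn_eq_sum E hE fun t ht htE => by
      rw [hmult t (hsub ⟨ht.1, ht.2.le⟩), hE0 t ht htE, Nat.cast_zero], Nat.cast_sum]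
    exact Finset.sum_congr rfl fun t ht => hmult t (hsub ⟨(hE ht).1, (hE ht).2.le⟩)
  rw [hcount, hneg ξ₁ hξ₁, hneg ξ₂ hξ₂]
  refine ⟨ENat.natCast_ne_top _, ENat.natCast_ne_top _, ENat.natCast_ne_top _, ?_⟩
  rw [ENat.toNat_natCast, ENat.toNat_natCast, ENat.toNat_natCast, hsum]
  push_cast
  ring
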